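/- **Setting.** Let $g:\mathbb R^n\times\mathbb R^m\to\mathbb R$ and $G=(g_1,\dots,g_s):\mathbb R^n\times\mathbb R^m\to\mathbb R^s$ be $C^2$, with $g(x,\cdot)$ and every $g_i(x,\cdot)$ convex for every $x\in\mathbb R^n$. Let $h:\mathbb R^s\to[-\infty,\infty]$ be proper, epi-polyhedral (its epigraph is a polyhedral set) and nondecreasing for the componentwise order, with conjugate $h^*(p)=\sup_z\{\langle z,p\rangle-h(z)\}$. For a function $f$ and a point $z$ with $f(z)$ finite, $\partial f(z)$ is the set of $u$ with $(u,-1)\in N_{\operatorname{epi} f}(z,f(z))$, and $\partial^\infty f(z)$ is the set of $u$ with $(u,0)\in N_{\operatorname{epi} f}(z,f(z))$, where $N$ is the (limiting) normal cone; for $u\in\partial f(z)$ the critical cone is $K_f(z,u)=N_{\partial f(z)}(u)$. Write $\operatorname{ri}$ for the relative interior and $C^\perp$ for the set of vectors orthogonal to all elements of $C$. The primal-dual solution mapping of the problem of minimizing $g(x,y)+h(G(x,y))$ over $y$ is $$S(x)=\Big\{(y,p)\in\mathbb R^m\times\mathbb R^s\ \Big|\ \begin{pmatrix}0\\0\end{pmatrix}\in\begin{pmatrix}-\nabla_yg(x,y)-\nabla_yG(x,y)^\top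 p\\-G(x,y)\end{pmatrix}+\{0\}\times\partial h^*(p)\Big\},$$ and $L(x,y,p)=g(x,y)+\langle G(x,y),p\rangle-h^*(p)$. **Theorem.** Let $x\in\mathbb R^n$, $y\in\mathbb R^m$, $p\in\mathbb R^s$ be such that $(y,p)\in S(x)$ and 1. (basic qualification) $u\in\partial^\infty h(G(x,y))$ and $\nabla_yG(x,y)^\top u=0$ imply $u=0$; 2. (relative interior condition) $G(x,y)\in\operatorname{ri}\big(\partial h^*(p)\big)$; 3. (second-order condition) with $K=K_{h^*}(p,G(x,y))$, for all $w\in\mathbb R^m$ and $z\in K$, $$-\nabla_yG(x,y)^\top z=\nabla^2_{yy}L(x,y,p)\,w\ \text{ and }\ -\nabla_yG(x,y)\,w\in K^\perp\quad\Longrightarrow\quad w=0,\ z=0.$$ Then $S(x)=\{(y,p)\}$, and there is an open neighborhood of $x$ on which $S$ is single-valued (each $S(x')$ is a singleton) and $C^1$ as a function. Moreover $K$ is a linear subspace and, for every matrix $B$ whose columns form a basis of $\mathbb R^m\times K$, the matrix $B^\top AB$ is invertible and $$\nabla S(x)=-B\,(B^\top AB)^{-1}B^\top\begin{pmatrix}\nabla_x\nabla_yL(x,y,p)\\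 \nabla_xG(x,y)\end{pmatrix},\qquad A=\begin{pmatrix}\nabla^2_{yy}L(x,y,p)&\nabla_yG(x,y)^\top\\ \nabla_yG(x,y)&0\end{pmatrix}.$$ -/

import Mathlib

namespace BilevelENLP

open Filter Topology

/-- The Euclidean space `ℝᵏ`. -/
abbrev E (k : ℕ) : Type := EuclideanSpace ℝ (Fin k)

section VariationalGeometry

variable {V : Type*} [NormedAddCommGroup V] [InnerProductSpace ℝ V]

/-- The (Bouligand) tangent cone `T_C(x̄)`. -/
def tangentCone (C : Set V) (x : V) : Set V :=
  {w | ∃ (c : ℕ → V) (τ : ℕ → ℝ), (∀ k, c k ∈ C) ∧ (∀ k, 0 < τ k) ∧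
    Tendsto τ atTop (𝓝 0) ∧ Tendsto (fun k => (τ k)⁻¹ • (c k - x)) atTop (𝓝 w)}

/-- The regular normal cone, the polar of the tangent cone. -/
def regularNormalCone (C : Set V) (x : V) : Set V :=
  {u | ∀ w ∈ tangentCone C x, inner ℝ w u ≤ 0}

/-- The (limiting) normal cone `N_C(x̄)`: limits of regular normals at points of `C`
converging to `x̄`. -/
def normalCone (C : Set V) (x : V) : Set V :=
  {u | ∃ c v : ℕ → V, (∀ k, c k ∈ C) ∧ Tendsto c atTop (𝓝 x) ∧
    (∀ k, v k ∈ regularNormalCone C (c k)) ∧ Tendsto v atTop (𝓝 u)}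

/-- A polyhedral set: a finite intersection of closed half-spaces. -/
def IsPolyhedral (C : Set V) : Prop :=
  ∃ F : Finset (V × ℝ), C = {v | ∀ q ∈ F, inner ℝ q.1 v ≤ q.2}

/-- The vectors orthogonal to every element of `C`. -/
def perp (C : Set V) : Set V :=
  {u | ∀ w ∈ C, inner ℝ w u = 0}

/-- The epigraph of `f`, in `V × ℝ` with its Euclidean structure. -/
def epigraph (f : V → EReal) : Set (WithLp 2 (V × ℝ)) :=
  {q | f q.fst ≤ (q.snd : EReal)}

/-- `f` is proper: not identically `∞`, and nowhere `-∞`. -/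
def IsProper (f : V → EReal) : Prop :=
  (∃ z, f z < ⊤) ∧ ∀ z, f z ≠ ⊥

/-- `f` is epi-polyhedral: its epigraph is a polyhedral set. -/
def IsEpiPolyhedral (f : V → EReal) : Prop :=
  IsPolyhedral (epigraph f)

/-- The subdifferential `∂f(z)`: at a point where `f` is finite, the vectors `u` for which
`(u, -1)` is normal to the epigraph at `(z, f z)`. -/
def subdiff (f : V → EReal) (z : V) : Set V :=
  {u | f z ≠ ⊤ ∧ f z ≠ ⊥ ∧
    WithLp.toLp 2 (u, (-1 : ℝ)) ∈ normalCone (epigraph f) (WithLp.toLp 2 (z, (f z).toReal))}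

/-- The horizon subdifferential `∂^∞ f(z)`: at a point where `f` is finite, the vectors `u` for
which `(u, 0)` is normal to the epigraph at `(z, f z)`. -/
def horizonSubdiff (f : V → EReal) (z : V) : Set V :=
  {u | f z ≠ ⊤ ∧ f z ≠ ⊥ ∧
    WithLp.toLp 2 (u, (0 : ℝ)) ∈ normalCone (epigraph f) (WithLp.toLp 2 (z, (f z).toReal))}

/-- The critical cone `K_f(z, u) = N_{∂f(z)}(u)`. -/
def criticalCone (f : V → EReal) (z u : V) : Set V :=
  normalCone (subdiff f z) u

/-- The conjugate function `f*(p) = sup_z (⟨z, p⟩ - f z)`. -/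
noncomputable def conj (f : V → EReal) (p : V) : EReal :=
  ⨆ z, ((inner ℝ z p : ℝ) : EReal) - f z

end VariationalGeometry

/-- `h` is nondecreasing for the componentwise order of `ℝˢ`. -/
def IsNondecreasing {s : ℕ} (h : E s → EReal) : Prop :=
  ∀ z z' : E s, (∀ i, z i ≤ z' i) → h z ≤ h z'

/-- The matrix of a linear map between Euclidean spaces in the standard bases. -/
noncomputable def mat {a b : ℕ} (T : E a →L[ℝ] E b) : Matrix (Fin b) (Fin a) ℝ :=
  LinearMap.toMatrix (EuclideanSpace.basisFun (Fin a) ℝ).toBasis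
    (EuclideanSpace.basisFun (Fin b) ℝ).toBasis (T : E a →ₗ[ℝ] E b)

section LowerLevel

variable {n m s : ℕ}

/-- The partial derivative (Jacobian) `∇_x G(x, y)`. -/
noncomputable def Gx (G : E n → E m → E s) (x : E n) (y : E m) : E n →L[ℝ] E s :=
  fderiv ℝ (fun x' => G x' y) x

/-- The partial derivative (Jacobian) `∇_y G(x, y)`. -/
noncomputable def Gy (G : E n → E m → E s) (x : E n) (y : E m) : E m →L[ℝ] E s :=
  fderiv ℝ (fun y' => G x y') y

/-- The primal-dual solution mapping `S`: the pairs `(y, p)` with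
`(0, 0) ∈ (-∇_y g(x, y) - ∇_y G(x, y)ᵀ p, -G(x, y)) + {0} × ∂h*(p)`. -/
def solutionMap (g : E n → E m → ℝ) (G : E n → E m → E s) (h : E s → EReal) (x : E n) :
    Set (E m × E s) :=
  {q | - gradient (fun y' => g x y') q.1 - ContinuousLinearMap.adjoint (Gy G x q.1) q.2 = 0 ∧
    ∃ v ∈ subdiff (conj h) q.2, - G x q.1 + v = 0}

/-- The basic qualification at `y` for `x`. -/
def BasicQualification (G : E n → E m → E s) (h : E s → EReal) (x : E n) (y : E m) : Prop :=
  ∀ u ∈ horizonSubdiff h (G x y), ContinuousLinearMap.adjoint (Gy G x y) u = 0 → u = 0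

/-- The Lagrangian `L(x, y, p) = g(x, y) + ⟨G(x, y), p⟩ - h*(p)` (for `p` with `h*(p)` finite). -/
noncomputable def lagrangian (g : E n → E m → ℝ) (G : E n → E m → E s) (h : E s → EReal)
    (x : E n) (y : E m) (p : E s) : ℝ :=
  g x y + inner ℝ (G x y) p - (conj h p).toReal

/-- `∇²_{yy} L(x, y, p)`, the derivative in `y` of the gradient of `L` in `y`. -/
noncomputable def Lyy (g : E n → E m → ℝ) (G : E n → E m → E s) (h : E s → EReal)
    (x : E n) (y : E m) (p : E s) : E m →L[ℝ] E m :=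
  fderiv ℝ (fun y' => gradient (fun y'' => lagrangian g G h x y'' p) y') y

/-- `∇_x ∇_y L(x, y, p)`, the derivative in `x` of the gradient of `L` in `y`. -/
noncomputable def Lxy (g : E n → E m → ℝ) (G : E n → E m → E s) (h : E s → EReal)
    (x : E n) (y : E m) (p : E s) : E n →L[ℝ] E m :=
  fderiv ℝ (fun x' => gradient (fun y' => lagrangian g G h x' y' p) y) x

/-- The second-order condition at `(x, y, p)`, for pairs `(w, z)` in
`ℝᵐ × K_{h*}(p, G(x, y))`. -/
def SecondOrderCondition (g : E n → E m → ℝ) (G : E n → E m → E s) (h : E s → EReal)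
    (x : E n) (y : E m) (p : E s) : Prop :=
  ∀ (w : E m) (z : E s), z ∈ criticalCone (conj h) p (G x y) →
    - ContinuousLinearMap.adjoint (Gy G x y) z = Lyy g G h x y p w →
    - Gy G x y w ∈ perp (criticalCone (conj h) p (G x y)) →
    w = 0 ∧ z = 0

/-- The KKT matrix `A`. -/
noncomputable def kktMatrix (g : E n → E m → ℝ) (G : E n → E m → E s) (h : E s → EReal)
    (x : E n) (y : E m) (p : E s) : Matrix (Fin m ⊕ Fin s) (Fin m ⊕ Fin s) ℝ :=
  Matrix.fromBlocks (mat (Lyy g G h x y p)) (mat (Gy G x y)).transpose (mat (Gy G x y)) 0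

end LowerLevel

/-- The set `ℝᵐ × K`, as a set of coordinate vectors. -/
def univProd (m : ℕ) {s : ℕ} (K : Set (E s)) : Set (Fin m ⊕ Fin s → ℝ) :=
  {v | ∃ (w : E m) (z : E s), z ∈ K ∧ v = Sum.elim ⇑w ⇑z}

/-- The columns of `B` form a basis of `C` (in particular, `C` is a linear subspace). -/
def ColumnsFormBasis {ι : Type*} {d : ℕ} (B : Matrix ι (Fin d) ℝ) (C : Set (ι → ℝ)) : Prop :=
  LinearIndependent ℝ B.col ∧ (Submodule.span ℝ (Set.range B.col) : Set (ι → ℝ)) = C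

end BilevelENLP

/-! ### Normal cones of convex sets, conjugates and polyhedral duality. -/

namespace BilevelENLP

open Filter Topology

/-! Polyhedrality and the relative interior condition reduce the generalized equation to smooth
equations. Put v = G(x, y) and let M be the direction of the affine hull of ∂h*(p). Then K = Mᗮ, and
near (p, v) the graph of ∂h* is the affine set (p + Mᗮ) × (v + M) (`subdiff_conj_locally_affine`).
Indeed h - ⟨·, p⟩ is minimal exactly on ∂h*(p) and, being polyhedral, grows linearly across that set
(`exists_sharpness`). Small tilts in Mᗮ therefore keep the same maximizers near v, while a tilt with
a component in M leaves no maximizer near v.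

Near (x, y, p) the solutions are thus given by stationarity in y, the restriction of the multiplier
to p + K, and the vanishing of the K-component of G - v. The second-order condition says that this
square system has an injective linearization, so the implicit function theorem gives a C¹ branch
containing all nearby solutions (`exists_local_solution`).

Convexity makes this global. Since h is nondecreasing, multipliers with h* finite are nonnegative,
so S(x') is the saddle set of a convex-concave function and hence convex (`convex_solutionMap`); a
convex set with an isolated point is a singleton. The Jacobian formula is the linearized system
written in the coordinates of B and tested against ℝᵐ × K (`jacobian_formula`). -/

theorem toLp_mem_epigraph {V : Type*} {f : V → EReal} {z : V} {t : ℝ} :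
    WithLp.toLp 2 (z, t) ∈ epigraph f ↔ f z ≤ t := Iff.rfl

theorem exists_le_coe {V : Type*} {f : V → EReal} (hf : IsProper f) : ∃ (z : V) (t : ℝ), f z ≤ t := by
  obtain ⟨⟨z, hz⟩, -⟩ := hf
  obtain ⟨t, ht⟩ := EReal.lt_iff_exists_real_btwn.1 hz
  exact ⟨z, t, ht.1.le⟩

section VariationalGeometry

variable {V : Type*} [NormedAddCommGroup V] [InnerProductSpace ℝ V]

theorem regularNormalCone_eq_of_convex {C : Set V} (hC : Convex ℝ C) {x : V} (hx : x ∈ C) :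
    regularNormalCone C x = {u | ∀ c ∈ C, inner ℝ (c - x) u ≤ 0} := by
  ext u
  simp only [regularNormalCone, tangentCone, Set.mem_ofPred_eq]
  constructor
  · intro hu c hc
    refine hu _ ⟨fun k : ℕ => x + (1 / ((k : ℝ) + 1)) • (c - x), fun k => 1 / ((k : ℝ) + 1),
      fun k => ?_, fun k => by positivity, tendsto_one_div_add_atTop_nhds_zero_nat, ?_⟩
    · refine hC.add_smul_sub_mem hx hc ⟨by positivity, ?_⟩
      rw [div_le_one (by positivity)]
      linarith [(Nat.cast_nonneg k : (0 : ℝ) ≤ k)]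
    · refine tendsto_const_nhds.congr fun k => ?_
      have : (1 / ((k : ℝ) + 1)) ≠ 0 := by positivity
      rw [add_sub_cancel_left, smul_smul, inv_mul_cancel₀ this, one_smul]
  · rintro hu w ⟨c, τ, hc, hτ, -, hw⟩
    refine le_of_tendsto (hw.inner tendsto_const_nhds) (Eventually.of_forall fun k => ?_)
    rw [real_inner_smul_left]
    exact mul_nonpos_of_nonneg_of_nonpos (inv_nonneg.2 (hτ k).le) (hu _ (hc k))

/-- The variational inequality defining regular normals of a convex set is closed under limits, so
limiting normals add nothing. -/
theorem normalCone_eq_of_convex {C : Set V} (hC : Convex ℝ C) {x : V} (hx : x ∈ C) :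
    normalCone C x = {u | ∀ c ∈ C, inner ℝ (c - x) u ≤ 0} := by
  ext u
  constructor
  · rintro ⟨c, v, hc, hcx, hv, hvu⟩ c' hc'
    refine le_of_tendsto ((tendsto_const_nhds.sub hcx).inner hvu) (Eventually.of_forall fun k => ?_)
    have := hv k
    rw [regularNormalCone_eq_of_convex hC (hc k)] at this
    exact this c' hc'
  · intro hu
    refine ⟨fun _ => x, fun _ => u, fun _ => hx, tendsto_const_nhds, fun _ => ?_,
      tendsto_const_nhds⟩
    rwa [regularNormalCone_eq_of_convex hC hx]

/-- Quantifying over real points of the epigraph avoids all extended-real subtraction later. -/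
theorem conj_le_iff {f : V → EReal} (hf : ∀ z, f z ≠ ⊥) {q : V} {t : ℝ} :
    conj f q ≤ t ↔ ∀ (z : V) (r : ℝ), f z ≤ r → inner ℝ z q - r ≤ t := by
  rw [conj, iSup_le_iff]
  refine forall_congr' fun z => ?_
  induction hz : f z with
  | bot => exact absurd hz (hf z)
  | top => simp
  | coe r =>
    have e : ((inner ℝ z q : ℝ) : EReal) - ((r : ℝ) : EReal) = ((inner ℝ z q - r : ℝ) : EReal) := by
      push_cast; rfl
    constructor
    · intro h1 r' hr'
      have h1 : inner ℝ z q - r ≤ t := EReal.coe_le_coe_iff.1 (e ▸ h1)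
      have : r ≤ r' := EReal.coe_le_coe_iff.1 hr'
      linarith
    · intro h1
      exact e.le.trans (EReal.coe_le_coe_iff.2 (h1 r le_rfl))

theorem convex_epigraph_conj {f : V → EReal} (hf : ∀ z, f z ≠ ⊥) :
    Convex ℝ (epigraph (conj f)) := by
  intro a ha b hb s t hs ht hst
  simp only [epigraph, Set.mem_ofPred_eq, conj_le_iff hf] at ha hb ⊢
  intro z r hr
  have h1 := mul_le_mul_of_nonneg_left (ha z r hr) hs
  have h2 := mul_le_mul_of_nonneg_left (hb z r hr) ht
  have h3 : r = s * r + t * r := by rw [← add_mul, hst, one_mul]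
  simp only [WithLp.add_fst, WithLp.smul_fst, WithLp.add_snd, WithLp.smul_snd, inner_add_right,
    real_inner_smul_right, smul_eq_mul]
  linarith

/-- The epigraph of a conjugate is convex, so normality of (v, -1) is the usual subgradient
inequality. -/
theorem mem_subdiff_conj_iff_forall {f : V → EReal} (hf : ∀ z, f z ≠ ⊥) {p v : V} :
    v ∈ subdiff (conj f) p ↔ ∃ c : ℝ, conj f p = c ∧
      ∀ (q : V) (t : ℝ), conj f q ≤ t → inner ℝ (q - p) v ≤ t - c := by
  have key : ∀ c : ℝ, conj f p = c → (WithLp.toLp 2 (v, (-1 : ℝ)) ∈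
      normalCone (epigraph (conj f)) (WithLp.toLp 2 (p, c)) ↔
      ∀ (q : V) (t : ℝ), conj f q ≤ t → inner ℝ (q - p) v ≤ t - c) := by
    intro c hc
    have hin : ∀ (q : V) (t : ℝ), inner ℝ (WithLp.toLp 2 (q, t) - WithLp.toLp 2 (p, c))
        (WithLp.toLp 2 (v, (-1 : ℝ))) = inner ℝ (q - p) v - (t - c) := by
      intro q t
      rw [← WithLp.toLp_sub, WithLp.prod_inner_apply, Prod.mk_sub_mk, Real.inner_apply]
      ring
    rw [normalCone_eq_of_convex (V := WithLp 2 (V × ℝ)) (convex_epigraph_conj hf)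
      (toLp_mem_epigraph.2 hc.le)]
    constructor
    · intro h q t hq
      have := h (WithLp.toLp 2 (q, t)) (toLp_mem_epigraph.2 hq)
      rw [hin] at this
      linarith
    · intro h w hw
      have h1 := h w.fst w.snd hw
      have h2 := hin w.fst w.snd
      change inner ℝ (w - _) _ = _ at h2
      rw [h2]
      linarith
  constructor
  · rintro ⟨h1, h2, h3⟩
    exact ⟨(conj f p).toReal, (EReal.coe_toReal h1 h2).symm,
      (key _ (EReal.coe_toReal h1 h2).symm).1 h3⟩
  · rintro ⟨c, hc, h⟩
    refine ⟨hc ▸ EReal.coe_ne_top c, hc ▸ EReal.coe_ne_bot c, ?_⟩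
    rw [hc, EReal.toReal_coe]
    exact (key c hc).2 h

/-- The epigraph of an epi-polyhedral function is described by finitely many linear
inequalities. -/
theorem IsEpiPolyhedral.exists_inequalities {f : V → EReal} (hf : IsEpiPolyhedral f) :
    ∃ (k : ℕ) (a : Fin k → V) (α β : Fin k → ℝ), ∀ (z : V) (t : ℝ),
      f z ≤ t ↔ ∀ j, inner ℝ (a j) z + α j * t ≤ β j := by
  obtain ⟨F, hF⟩ := hf
  refine ⟨F.card, fun j => (F.equivFin.symm j).1.1.fst, fun j => (F.equivFin.symm j).1.1.snd,
    fun j => (F.equivFin.symm j).1.2, fun z t => ?_⟩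
  rw [← toLp_mem_epigraph, hF]
  have key : ∀ q : WithLp 2 (V × ℝ), inner ℝ q (WithLp.toLp 2 (z, t)) =
      inner ℝ q.fst z + q.snd * t := fun q => by
    rw [WithLp.prod_inner_apply, Real.inner_apply]
    rfl
  constructor
  · intro h j
    rw [← key]
    exact h _ (F.equivFin.symm j).2
  · intro h q hq
    have := h (F.equivFin ⟨q, hq⟩)
    simp only [Equiv.symm_apply_apply] at this
    rwa [key]

/-- An epigraph is unbounded upwards, so no constraint may bound the last coordinate from above. -/
theorem coeff_nonpos_of_inequalities {f : V → EReal} (hf : IsProper f) {k : ℕ} {a : Fin k → V}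
    {α β : Fin k → ℝ}
    (hF : ∀ (z : V) (t : ℝ), f z ≤ t ↔ ∀ j, inner ℝ (a j) z + α j * t ≤ β j) (j : Fin k) :
    α j ≤ 0 := by
  obtain ⟨⟨z, hz⟩, -⟩ := hf
  obtain ⟨t, ht⟩ := EReal.lt_iff_exists_real_btwn.1 hz
  by_contra! hpos
  set t' := max t ((β j - inner ℝ (a j) z) / α j + 1)
  have h1 : f z ≤ t' := ht.1.le.trans (EReal.coe_le_coe_iff.2 (le_max_left _ _))
  have h2 := (hF z t').1 h1 j
  have h3 : (β j - inner ℝ (a j) z) / α j < t' :=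
    lt_of_lt_of_le (by linarith) (le_max_right _ _)
  rw [div_lt_iff₀ hpos] at h3
  linarith

theorem conj_eq_of_forall {f : V → EReal} (hf : ∀ z, f z ≠ ⊥) {p v : V} {r : ℝ} (hr : f v ≤ r)
    (h : ∀ (z : V) (t : ℝ), f z ≤ t → inner ℝ z p - t ≤ inner ℝ v p - r) :
    conj f p = ((inner ℝ v p - r : ℝ) : EReal) := by
  refine le_antisymm ((conj_le_iff hf).2 h) ?_
  refine EReal.le_of_forall_lt_iff_le.1 fun t ht => ?_
  exact EReal.coe_le_coe_iff.2 ((conj_le_iff hf).1 ht.le v r hr)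

theorem conj_ne_bot {f : V → EReal} (hf : IsProper f) (p : V) : conj f p ≠ ⊥ := by
  obtain ⟨z, t, hz⟩ := exists_le_coe hf
  intro hbot
  have := (conj_le_iff (q := p) (t := inner ℝ z p - t - 1) hf.2).1 (by rw [hbot]; exact bot_le) z t hz
  linarith

/-- Fenchel duality for the subgradients of the conjugate of a polyhedral function. -/
theorem mem_subdiff_conj_iff {f : V → EReal} (hf : IsProper f) (hpoly : IsEpiPolyhedral f)
    {p v : V} : v ∈ subdiff (conj f) p ↔ ∃ r : ℝ, f v ≤ r ∧
      ∀ (z : V) (t : ℝ), f z ≤ t → inner ℝ z p - t ≤ inner ℝ v p - r := by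
  rw [mem_subdiff_conj_iff_forall hf.2]
  constructor
  · rintro ⟨c, hc, h⟩
    have hle := (conj_le_iff hf.2).1 hc.le
    refine ⟨inner ℝ v p - c, ?_, fun z t hz => by linarith [hle z t hz]⟩
    obtain ⟨k, a, α, β, hF⟩ := hpoly.exists_inequalities
    rw [hF]
    intro j
    by_contra! hlt
    rcases (coeff_nonpos_of_inequalities hf hF j).lt_or_eq with hneg | h0
    -- With γ = -1/α j the violated constraint reads as an affine minorant of `f` with slope γ • a
    -- j. This bounds the conjugate at that slope, against the subgradient inequality there.
    · obtain ⟨γ, hγ, hαγ⟩ : ∃ γ : ℝ, 0 < γ ∧ γ * α j = -1 :=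
        ⟨(-α j)⁻¹, by rw [inv_pos]; linarith, by rw [inv_neg, neg_mul, inv_mul_cancel₀ hneg.ne]⟩
      have h1 : conj f (γ • a j) ≤ ((γ * β j : ℝ) : EReal) := by
        rw [conj_le_iff hf.2]
        intro z t hz
        have h3 := mul_le_mul_of_nonneg_left ((hF z t).1 hz j) hγ.le
        rw [real_inner_smul_right, real_inner_comm]
        rw [mul_add, ← mul_assoc, hαγ] at h3
        linarith
      have h2 := h _ _ h1
      rw [inner_sub_left, real_inner_smul_left, real_inner_comm v p] at h2
      have h3 := mul_lt_mul_of_pos_left hlt hγ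
      rw [mul_add, ← mul_assoc, hαγ] at h3
      linarith
    -- A constraint without t only cuts the domain of `f`: adding `a j` to p raises the conjugate by
    -- at most `β j`.
    · have h1 : conj f (p + a j) ≤ ((c + β j : ℝ) : EReal) := by
        rw [conj_le_iff hf.2]
        intro z t hz
        have := (hF z t).1 hz j
        rw [h0] at this
        rw [inner_add_right]
        linarith [hle z t hz, real_inner_comm z (a j)]
      have h2 := h _ _ h1
      rw [h0] at hlt
      rw [add_sub_cancel_left] at h2
      linarith
  · rintro ⟨r, hr, h⟩
    refine ⟨_, conj_eq_of_forall hf.2 hr h, fun q t hq => ?_⟩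
    have := (conj_le_iff hf.2).1 hq v r hr
    rw [inner_sub_left, real_inner_comm v q, real_inner_comm v p]
    linarith

end VariationalGeometry
end BilevelENLP

/-! ### Local affine structure of the graph of the subdifferential. -/

namespace BilevelENLP

open Filter Topology

section Reduction

variable {V : Type*} [NormedAddCommGroup V] [InnerProductSpace ℝ V]

theorem mem_orthogonal_of_inner_nonpos {M : Submodule ℝ V} {u : V} {ε : ℝ} (hε : 0 < ε)
    (h : ∀ m ∈ M, ‖m‖ < ε → inner ℝ m u ≤ 0) : u ∈ Mᗮ := by
  have key : ∀ m ∈ M, inner ℝ m u ≤ 0 := by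
    intro m hm
    have hpos : 0 < ε / (‖m‖ + 1) := by positivity
    have := h ((ε / (‖m‖ + 1)) • m) (M.smul_mem _ hm) (by
      rw [norm_smul, Real.norm_of_nonneg hpos.le, div_mul_eq_mul_div, div_lt_iff₀ (by positivity)]
      nlinarith)
    rw [real_inner_smul_left] at this
    exact nonpos_of_mul_nonpos_right this hpos
  rw [Submodule.mem_orthogonal]
  intro m hm
  refine le_antisymm (key m hm) ?_
  have := key (-m) (M.neg_mem hm)
  rw [inner_neg_left] at this
  linarith

theorem convex_subdiff_conj {f : V → EReal} (hf : ∀ z, f z ≠ ⊥) (p : V) :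
    Convex ℝ (subdiff (conj f) p) := by
  intro a ha b hb s t hs ht hst
  rw [mem_subdiff_conj_iff_forall hf] at ha hb ⊢
  obtain ⟨r, hr, ha⟩ := ha
  obtain ⟨r', hr', hb⟩ := hb
  obtain rfl : r = r' := EReal.coe_injective (hr.symm.trans hr')
  refine ⟨r, hr, fun q τ hq => ?_⟩
  have h1 := mul_le_mul_of_nonneg_left (ha q τ hq) hs
  have h2 := mul_le_mul_of_nonneg_left (hb q τ hq) ht
  rw [inner_add_right, real_inner_smul_right, real_inner_smul_right]
  have h3 : τ - r = s * (τ - r) + t * (τ - r) := by rw [← add_mul, hst, one_mul]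
  linarith

theorem exists_ball_of_mem_intrinsicInterior {D : Set V} {v : V}
    (hv : v ∈ intrinsicInterior ℝ D) : v ∈ D ∧ (∀ d ∈ D, d - v ∈ (affineSpan ℝ D).direction) ∧
      ∃ ε > 0, ∀ m ∈ (affineSpan ℝ D).direction, ‖m‖ < ε → v + m ∈ D := by
  have hvD := intrinsicInterior_subset hv
  have hvA := subset_affineSpan ℝ D hvD
  refine ⟨hvD, fun d hd => AffineSubspace.vsub_mem_direction (subset_affineSpan ℝ D hd) hvA, ?_⟩
  obtain ⟨w, hw, rfl⟩ := mem_intrinsicInterior.1 hv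
  obtain ⟨ε, hε, hball⟩ := Metric.mem_nhds_iff.1 (mem_interior_iff_mem_nhds.1 hw)
  refine ⟨ε, hε, fun m hm hmε => ?_⟩
  have hmem : (w : V) + m ∈ affineSpan ℝ D := by
    rw [add_comm]
    exact AffineSubspace.vadd_mem_of_mem_direction hm hvA
  have : (⟨(w : V) + m, hmem⟩ : affineSpan ℝ D) ∈ Metric.ball w ε := by
    rw [Metric.mem_ball, Subtype.dist_eq, dist_eq_norm]
    simpa using hmε
  exact hball this

variable {k : ℕ} {c : Fin k → V} {α γ : Fin k → ℝ} {M : Submodule ℝ V}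

/-- A linear functional that is nonpositive on a ball of M vanishes on M; here it comes from a
constraint active at the origin. The data c, α, γ will describe an epigraph recentred at a
subgradient and tilted by p. -/
theorem coeff_mem_orthogonal {ε : ℝ} (hε : 0 < ε)
    (hin : ∀ m ∈ M, ‖m‖ < ε → ∀ j, inner ℝ (c j) m ≤ γ j) {j : Fin k} (hj : γ j = 0) :
    c j ∈ Mᗮ :=
  mem_orthogonal_of_inner_nonpos hε fun m hm hmε => by
    rw [real_inner_comm, ← hj]
    exact hin m hm hmε j

theorem eventually_slack (c : Fin k → V) (α γ : Fin k → ℝ) :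
    ∀ᶠ q : V × ℝ in 𝓝 0, ∀ j, 0 < γ j → inner ℝ (c j) q.1 + α j * q.2 < γ j := by
  rw [eventually_all]
  intro j
  by_cases hj : 0 < γ j
  · have hc : Continuous fun q : V × ℝ => inner ℝ (c j) q.1 + α j * q.2 := by fun_prop
    have := hc.tendsto 0
    simp only [Prod.fst_zero, Prod.snd_zero, inner_zero_right, mul_zero, add_zero] at this
    filter_upwards [this.eventually_lt_const hj] with q hq _ using hq
  · exact Eventually.of_forall fun q h => absurd h hj

variable [FiniteDimensional ℝ V]

/-- A polyhedral function with minimum `0` grows linearly away from its set of minimizers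
in the directions orthogonal to that set. -/
theorem exists_sharpness (hα : ∀ j, α j ≤ 0) (hγ : ∀ j, 0 ≤ γ j)
    (hτ : ∀ d τ, (∀ j, inner ℝ (c j) d + α j * τ ≤ γ j) → 0 ≤ τ)
    (hD : ∀ d, (∀ j, inner ℝ (c j) d ≤ γ j) → d ∈ M) {ε : ℝ} (hε : 0 < ε)
    (hin : ∀ m ∈ M, ‖m‖ < ε → ∀ j, inner ℝ (c j) m ≤ γ j) :
    ∃ δ : ℝ, 0 < δ ∧ ∀ d τ, (∀ j, inner ℝ (c j) d + α j * τ ≤ γ j) →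
      δ * ‖Mᗮ.starProjection d‖ ≤ τ := by
  classical
  -- φ is the total violation of the constraints active at the origin. It is positively homogeneous,
  -- so a positive lower bound on the compact unit sphere of Mᗮ suffices.
  set φ : V → ℝ := fun d => ∑ j, if γ j = 0 then max 0 (inner ℝ (c j) d) else 0 with hφ
  have hφc : Continuous φ := by
    refine continuous_finsetSum _ fun j _ => ?_
    split_ifs <;> fun_prop
  have hφpos : ∀ d ∈ Metric.sphere (0 : V) 1 ∩ (Mᗮ : Set V), 0 < φ d := by
    rintro d ⟨hd1, hdM⟩
    have hd0 : d ≠ 0 := fun h => by simp [h] at hd1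
    have hterm : ∀ j, 0 ≤ if γ j = 0 then max 0 (inner ℝ (c j) d) else 0 := fun j => by
      split_ifs <;> simp
    by_contra! hle
    have h0 : φ d = 0 := le_antisymm hle (Finset.sum_nonneg fun j _ => hterm j)
    have h1 := (Finset.sum_eq_zero_iff_of_nonneg fun j _ => hterm j).1 h0
    have h2 : ∀ j, γ j = 0 → inner ℝ (c j) d ≤ 0 := fun j hj => by
      have := h1 j (Finset.mem_univ _)
      rw [if_pos hj] at this
      exact max_eq_left_iff.1 this
    -- For small t > 0 the inactive constraints hold by slack and the active ones by sign, which
    -- puts t • d in M as well as in Mᗮ.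
    have hcont : Continuous fun t : ℝ => ((t • d, 0) : V × ℝ) := by fun_prop
    have hev := (hcont.tendsto' 0 0 (by simp)).eventually (eventually_slack c α γ)
    obtain ⟨t, ht, htpos⟩ := ((hev.filter_mono nhdsWithin_le_nhds).and
      (self_mem_nhdsWithin (s := Set.Ioi (0 : ℝ)))).exists
    have htpos : 0 < t := htpos
    have hmem : t • d ∈ M := hD _ fun j => by
      rcases (hγ j).eq_or_lt with h | h
      · rw [← h, real_inner_smul_right]
        exact mul_nonpos_of_nonneg_of_nonpos htpos.le (h2 j h.symm)
      · simpa using (ht j h).le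
    have hmem' : d ∈ M := (M.smul_mem_iff htpos.ne').1 hmem
    exact hd0 (inner_self_eq_zero.1 (M.inner_right_of_mem_orthogonal hmem' hdM))
  have hcomp : IsCompact (Metric.sphere (0 : V) 1 ∩ (Mᗮ : Set V)) :=
    (isCompact_sphere _ _).inter_right M.isClosed_orthogonal
  obtain ⟨μ, hμ, hμle⟩ := hcomp.exists_forall_le' hφc.continuousOn hφpos
  set A : ℝ := ∑ j, -α j with hA
  have hA0 : 0 ≤ A := Finset.sum_nonneg fun j _ => by linarith [hα j]
  -- With e the Mᗮ-part of d, μ‖e‖ ≤ φ e ≤ A τ; the added 1 keeps the denominator positive.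
  refine ⟨μ / (A + 1), by positivity, fun d τ h => ?_⟩
  have hτ0 := hτ d τ h
  set e := Mᗮ.starProjection d with he
  have heM : e ∈ Mᗮ := Submodule.starProjection_apply_mem _ _
  rw [div_mul_eq_mul_div, div_le_iff₀ (by positivity)]
  have hupper : φ e ≤ A * τ := by
    rw [hA, Finset.sum_mul]
    refine Finset.sum_le_sum fun j _ => ?_
    have hnn : 0 ≤ -α j * τ := mul_nonneg (by linarith [hα j]) hτ0
    split_ifs with hj
    · refine max_le hnn ?_
      have hcj := coeff_mem_orthogonal hε hin hj
      have : inner ℝ (c j) e = inner ℝ (c j) d := by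
        rw [he, ← Submodule.inner_starProjection_left_eq_right,
          Submodule.starProjection_eq_self_iff.2 hcj]
      rw [this]
      linarith [h j, hj]
    · exact hnn
  have hlower : μ * ‖e‖ ≤ φ e := by
    rcases eq_or_ne e 0 with h0 | h0
    · rw [h0]
      simp [hφ]
    · have hn : 0 < ‖e‖ := norm_pos_iff.2 h0
      have h1 := hμle (‖e‖⁻¹ • e) ⟨by simp [norm_smul, hn.ne'], Mᗮ.smul_mem _ heM⟩
      have h2 : φ (‖e‖⁻¹ • e) = ‖e‖⁻¹ * φ e := by
        simp only [hφ, Finset.mul_sum]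
        refine Finset.sum_congr rfl fun j _ => ?_
        split_ifs
        · rw [real_inner_smul_right, mul_max_of_nonneg _ _ (inv_nonneg.2 hn.le), mul_zero]
        · simp
      rw [h2, inv_mul_eq_div, le_div_iff₀ hn] at h1
      exact h1
  nlinarith

theorem inner_eq_inner_starProjection {d u : V} {K : Submodule ℝ V} (hu : u ∈ K) :
    inner ℝ d u = inner ℝ (K.starProjection d) u := by
  rw [Submodule.inner_starProjection_left_eq_right, Submodule.starProjection_eq_self_iff.2 hu]

/-- A tilt u ∈ Mᗮ smaller than the growth rate δ cannot pay for leaving M. Conversely, a maximizer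
near the origin can be moved freely along M, which forces u ⊥ M. -/
theorem eventually_maximizer_iff (hα : ∀ j, α j ≤ 0) (hγ : ∀ j, 0 ≤ γ j)
    (hτ : ∀ d τ, (∀ j, inner ℝ (c j) d + α j * τ ≤ γ j) → 0 ≤ τ)
    (hD : ∀ d, (∀ j, inner ℝ (c j) d ≤ γ j) → d ∈ M) {ε : ℝ} (hε : 0 < ε)
    (hin : ∀ m ∈ M, ‖m‖ < ε → ∀ j, inner ℝ (c j) m ≤ γ j) :
    ∀ᶠ q : V × V in 𝓝 0, (∃ τ, (∀ j, inner ℝ (c j) q.2 + α j * τ ≤ γ j) ∧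
      ∀ z t, (∀ j, inner ℝ (c j) z + α j * t ≤ γ j) → inner ℝ z q.1 - t ≤ inner ℝ q.2 q.1 - τ) ↔
      q.1 ∈ Mᗮ ∧ q.2 ∈ M := by
  obtain ⟨δ, hδ, hsharp⟩ := exists_sharpness hα hγ hτ hD hε hin
  obtain ⟨ρ, hρ, hslack⟩ := Metric.eventually_nhds_iff.1 (eventually_slack c α γ)
  -- The radius keeps the tilt below δ, makes τ ≤ ‖d‖ (hence the 1), keeps d in the ball of feasible
  -- points of M, and leaves room ρ / 2 for a further move along M.
  have hball : ∀ᶠ q : V × V in 𝓝 0, ‖q‖ < min (min δ 1) (min ε (ρ / 2)) := by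
    have := Metric.ball_mem_nhds (0 : V × V) (ε := min (min δ 1) (min ε (ρ / 2)))
      (lt_min (lt_min hδ one_pos) (lt_min hε (half_pos hρ)))
    filter_upwards [this] with q hq using by simpa using hq
  filter_upwards [hball] with ⟨u, d⟩ hq
  simp only [Prod.norm_mk, lt_min_iff, max_lt_iff] at hq
  obtain ⟨⟨⟨huδ, -⟩, hu1, -⟩, ⟨-, hdε⟩, -, hdρ⟩ := hq
  have hcs : ∀ z, u ∈ Mᗮ → inner ℝ z u ≤ ‖Mᗮ.starProjection z‖ * ‖u‖ := fun z hu => by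
    rw [inner_eq_inner_starProjection hu]
    exact real_inner_le_norm _ _
  constructor
  · rintro ⟨τ, hP, hmax⟩
    have h0 := hmax 0 0 fun j => by simpa using hγ j
    rw [inner_zero_left] at h0
    have hτ0 := hτ d τ hP
    have hτd : τ ≤ ‖d‖ := by
      have := real_inner_le_norm d u
      have := mul_le_of_le_one_right (norm_nonneg d) hu1.le
      linarith
    -- Adding a small m ∈ M preserves feasibility: active constraints do not see m and the others
    -- have slack.
    have hu : u ∈ Mᗮ := by
      refine mem_orthogonal_of_inner_nonpos (half_pos hρ) fun m hm hmρ => ?_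
      have := hmax (d + m) τ fun j => by
        rcases (hγ j).eq_or_lt with h | h
        · rw [inner_add_right, M.inner_left_of_mem_orthogonal hm
            (coeff_mem_orthogonal hε hin h.symm), add_zero]
          exact hP j
        · refine (hslack (y := (d + m, τ)) ?_ j h).le
          rw [dist_zero_right, Prod.norm_mk, max_lt_iff, Real.norm_of_nonneg hτ0]
          exact ⟨by linarith [norm_add_le d m], by linarith⟩
      rw [inner_add_left] at this
      linarith
    refine ⟨hu, ?_⟩
    have h1 := hsharp d τ hP
    have h2 := hcs d hu
    -- With P the projection onto Mᗮ, δ‖P d‖ ≤ τ ≤ ⟨d, u⟩ ≤ ‖P d‖‖u‖ and ‖u‖ < δ.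
    have h3 : ‖Mᗮ.starProjection d‖ = 0 := by
      by_contra hne
      have := (norm_nonneg (Mᗮ.starProjection d)).lt_of_ne' hne
      nlinarith
    rw [norm_eq_zero, Submodule.starProjection_apply_eq_zero_iff,
      Submodule.orthogonal_orthogonal] at h3
    exact h3
  · rintro ⟨hu, hd⟩
    refine ⟨0, fun j => by simpa using hin d hd hdε j, fun z t hz => ?_⟩
    have h1 := hsharp z t hz
    have h2 := hcs z hu
    rw [M.inner_right_of_mem_orthogonal hd hu]
    nlinarith [norm_nonneg (Mᗮ.starProjection z)]

/-- At a subgradient in the relative interior, the critical cone is the orthogonal complement of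
the direction of the subdifferential, and the graph of the subdifferential is locally affine. -/
theorem subdiff_conj_locally_affine {f : V → EReal} (hf : IsProper f) (hpoly : IsEpiPolyhedral f)
    {p v : V} (hv : v ∈ intrinsicInterior ℝ (subdiff (conj f) p)) :
    ∃ M : Submodule ℝ V, criticalCone (conj f) p v = (Mᗮ : Set V) ∧
      ∀ᶠ q : V × V in 𝓝 (p, v), q.2 ∈ subdiff (conj f) q.1 ↔ q.1 - p ∈ Mᗮ ∧ q.2 - v ∈ M := by
  obtain ⟨hvD, hsub, ε, hε, hin⟩ := exists_ball_of_mem_intrinsicInterior hv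
  set M := (affineSpan ℝ (subdiff (conj f) p)).direction
  refine ⟨M, ?_, ?_⟩
  · rw [criticalCone, normalCone_eq_of_convex (convex_subdiff_conj hf.2 p) hvD]
    ext u
    constructor
    · intro hu
      refine mem_orthogonal_of_inner_nonpos hε fun m hm hmε => ?_
      simpa using hu _ (hin m hm hmε)
    · intro hu d hd
      exact (M.inner_right_of_mem_orthogonal (hsub d hd) hu).le
  obtain ⟨r, hr, hmax⟩ := (mem_subdiff_conj_iff hf hpoly).1 hvD
  obtain ⟨k, a, α, β, hF⟩ := hpoly.exists_inequalities
  -- Recentring at (v, r) and subtracting the slope p: τ bounds the excess of `f` over its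
  -- supporting affine function, and it vanishes on the subdifferential.
  have hF' : ∀ d τ, f (v + d) ≤ ((inner ℝ d p + r + τ : ℝ) : EReal) ↔
      ∀ j, inner ℝ (a j + α j • p) d + α j * τ ≤ β j - inner ℝ (a j) v - α j * r := by
    intro d τ
    rw [hF]
    refine forall_congr' fun j => ?_
    rw [inner_add_left, inner_add_right, real_inner_smul_left, real_inner_comm p d]
    constructor <;> intro h <;> linarith
  have hD : ∀ d, v + d ∈ subdiff (conj f) p ↔ f (v + d) ≤ ((inner ℝ d p + r + 0 : ℝ) : EReal) := by
    intro d
    rw [mem_subdiff_conj_iff hf hpoly]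
    constructor
    · rintro ⟨t, ht, htmax⟩
      have h1 := htmax v r hr
      have h2 := hmax _ t ht
      rw [inner_add_left] at h1 h2
      convert ht using 2
      linarith
    · intro h
      refine ⟨_, h, fun z t hz => (hmax z t hz).trans ?_⟩
      rw [inner_add_left]
      linarith
  have key := eventually_maximizer_iff (M := M) (c := fun j => a j + α j • p) (α := α)
    (γ := fun j => β j - inner ℝ (a j) v - α j * r) (coeff_nonpos_of_inequalities hf hF)
    (fun j => by simpa using (hF' 0 0).1 (by simpa using hr) j)
    (fun d τ h => by
      have := hmax _ _ ((hF' d τ).2 h)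
      rw [inner_add_left] at this
      linarith)
    (fun d h => by simpa using hsub _ ((hD d).2 ((hF' d 0).2 (by simpa using h)))) hε
    (fun m hm hmε => by simpa using (hF' m 0).1 ((hD m).1 (hin m hm hmε)))
  have hshift : Tendsto (fun q : V × V => q - (p, v)) (𝓝 (p, v)) (𝓝 0) :=
    Continuous.tendsto' (by fun_prop) _ _ (sub_self _)
  filter_upwards [hshift.eventually key] with ⟨q₁, q₂⟩ hq
  rw [Prod.mk_sub_mk] at hq
  simp only [← hF'] at hq
  rw [← hq, mem_subdiff_conj_iff hf hpoly]
  constructor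
  · rintro ⟨t, ht, htmax⟩
    refine ⟨t - inner ℝ (q₂ - v) p - r, by simpa using ht, fun z τ hz => ?_⟩
    have := htmax _ _ hz
    simp only [inner_add_left, inner_sub_left, inner_sub_right] at this ⊢
    linarith
  · rintro ⟨τ, ht, htmax⟩
    rw [add_sub_cancel] at ht
    refine ⟨_, ht, fun z t hz => ?_⟩
    have := htmax (z - v) (t - inner ℝ (z - v) p - r) (by simpa using hz)
    simp only [inner_sub_left, inner_sub_right] at this ⊢
    linarith

end Reduction
end BilevelENLP

/-! ### Saddle points and convexity of the solution set. -/

namespace BilevelENLP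

open Filter Topology

section Saddle

theorem ConvexOn.le_of_hasFDerivAt_zero {F : Type*} [NormedAddCommGroup F] [NormedSpace ℝ F]
    {f : F → ℝ} (hf : ConvexOn ℝ Set.univ f) {y : F} (hd : HasFDerivAt f (0 : F →L[ℝ] ℝ) y)
    (z : F) : f y ≤ f z := by
  have hline : HasDerivAt (fun t : ℝ => f (y + t • (z - y))) 0 0 := by
    have h1 : HasDerivAt (fun t : ℝ => y + t • (z - y)) (z - y) 0 := by
      simpa using ((hasDerivAt_id (0 : ℝ)).smul_const (z - y)).const_add y
    have h2 : HasFDerivAt f (0 : F →L[ℝ] ℝ) (y + (0 : ℝ) • (z - y)) := by simpa using hd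
    exact (h2.comp_hasDerivAt (0 : ℝ) h1).congr_deriv (by simp)
  have hlim := hline.tendsto_slope_zero_right
  refine sub_nonneg.1 (le_of_tendsto hlim ?_)
  filter_upwards [Ioo_mem_nhdsGT (zero_lt_one' ℝ)] with t ht
  have h1 := hf.2 (Set.mem_univ y) (Set.mem_univ z) (sub_nonneg.2 ht.2.le) ht.1.le
    (sub_add_cancel 1 t)
  have h2 : (1 - t) • y + t • z = y + t • (z - y) := by module
  rw [h2] at h1
  simp only [zero_add, zero_smul, add_zero, smul_eq_mul] at h1 ⊢
  rw [inv_mul_le_iff₀ ht.1]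
  linarith

/-- Lowering coordinate i never increases `h`, so a negative `p i` would make the supremum infinite.
-/
theorem nonneg_of_conj_le {s : ℕ} {h : E s → EReal} (hproper : IsProper h)
    (hmono : IsNondecreasing h) {p : E s} {c : ℝ} (hp : conj h p ≤ c) (i : Fin s) : 0 ≤ p i := by
  obtain ⟨z, t, hz⟩ := exists_le_coe hproper
  by_contra! hneg
  have key : ∀ r : ℝ, 0 ≤ r → inner ℝ z p - r * p i - t ≤ c := by
    intro r hr
    have h1 : h (z - r • EuclideanSpace.single i 1) ≤ t := by
      refine (hmono _ _ fun j => ?_).trans hz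
      by_cases hj : j = i <;> simp [hj, hr]
    have h2 := (conj_le_iff hproper.2).1 hp _ t h1
    rw [inner_sub_left, real_inner_smul_left, EuclideanSpace.inner_single_left] at h2
    simpa using h2
  -- This step length r makes -r * p i exceed the available gap by at least 1.
  have h1 := key ((|c - inner ℝ z p + t| + 1) / (-p i)) (div_nonneg (by positivity) (by linarith))
  have h2 : (|c - inner ℝ z p + t| + 1) / (-p i) * p i = -(|c - inner ℝ z p + t| + 1) := by
    have : p i ≠ 0 := hneg.ne
    field_simp
  rw [h2] at h1
  linarith [le_abs_self (c - inner ℝ z p + t)]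

variable {n m s : ℕ} {g : E n → E m → ℝ} {G : E n → E m → E s} {h : E s → EReal}

theorem mem_solutionMap_iff {x : E n} {y : E m} {p : E s} :
    (y, p) ∈ solutionMap g G h x ↔
      gradient (fun y' => g x y') y + ContinuousLinearMap.adjoint (Gy G x y) p = 0 ∧
        G x y ∈ subdiff (conj h) p := by
  simp only [solutionMap, Set.mem_ofPred_eq]
  refine and_congr ?_ ?_
  · rw [← neg_eq_zero, neg_sub, sub_neg_eq_add, add_comm]
  · constructor
    · rintro ⟨v, hv, hv'⟩
      rwa [neg_add_eq_zero.1 hv']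
    · exact fun hv => ⟨_, hv, neg_add_cancel _⟩

theorem differentiable_section {F : Type*} [NormedAddCommGroup F] [NormedSpace ℝ F]
    {f : E n → E m → F} (hf : ContDiff ℝ 2 (Function.uncurry f)) (x : E n) :
    Differentiable ℝ (fun y => f x y) :=
  (hf.comp (contDiff_prodMk_right x)).differentiable (by norm_num)

theorem hasGradientAt_lagrangian (hg : ContDiff ℝ 2 (Function.uncurry g))
    (hG : ContDiff ℝ 2 (Function.uncurry G)) (x : E n) (y : E m) (p : E s) :
    HasGradientAt (fun y' => lagrangian g G h x y' p)
      (gradient (fun y' => g x y') y + ContinuousLinearMap.adjoint (Gy G x y) p) y := by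
  have h1 := (differentiable_section hg x y).hasGradientAt.hasFDerivAt
  have h2 := (differentiable_section hG x y).hasFDerivAt
  have h3 := (h1.add (h2.inner ℝ (hasFDerivAt_const p y))).sub_const (conj h p).toReal
  rw [hasGradientAt_iff_hasFDerivAt]
  refine h3.congr_fderiv ?_
  ext w
  simp [Gy, ContinuousLinearMap.adjoint_inner_left, real_inner_comm]

theorem convexOn_add_inner {g : E m → ℝ} {G : E m → E s} (hg : ConvexOn ℝ Set.univ g)
    (hG : ∀ i, ConvexOn ℝ Set.univ fun y => G y i) {q : E s} (hq : ∀ i, 0 ≤ q i) :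
    ConvexOn ℝ Set.univ fun y => g y + inner ℝ (G y) q := by
  refine hg.add ⟨convex_univ, fun a _ b _ s t hs ht hst => ?_⟩
  simp only [PiLp.inner_apply, Real.inner_apply, smul_eq_mul, Finset.mul_sum]
  rw [← Finset.sum_add_distrib]
  refine Finset.sum_le_sum fun i _ => ?_
  have := mul_le_mul_of_nonneg_right ((hG i).2 (Set.mem_univ a) (Set.mem_univ b) hs ht hst) (hq i)
  simp only [smul_eq_mul] at this
  linarith

/-- Nonnegative multipliers make the Lagrangian convex in y, so stationarity is global minimality;
the inclusion in ∂h* is maximality in the multiplier. -/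
theorem mem_solutionMap_iff_saddle (hg : ContDiff ℝ 2 (Function.uncurry g))
    (hG : ContDiff ℝ 2 (Function.uncurry G))
    (hgconv : ∀ x, ConvexOn ℝ Set.univ (fun y => g x y))
    (hGconv : ∀ x i, ConvexOn ℝ Set.univ (fun y => G x y i))
    (hproper : IsProper h) (hmono : IsNondecreasing h) {x : E n} {y : E m} {p : E s} :
    (y, p) ∈ solutionMap g G h x ↔ ∃ c : ℝ, conj h p = c ∧
      (∀ y', g x y + inner ℝ (G x y) p ≤ g x y' + inner ℝ (G x y') p) ∧
      ∀ (q : E s) (t : ℝ), conj h q ≤ t → inner ℝ (G x y) q - t ≤ inner ℝ (G x y) p - c := by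
  have hgrad := hasGradientAt_lagrangian (h := h) hg hG x y p
  rw [mem_solutionMap_iff, mem_subdiff_conj_iff_forall hproper.2]
  have hrw : ∀ (q : E s) (t c : ℝ), inner ℝ (q - p) (G x y) ≤ t - c ↔
      inner ℝ (G x y) q - t ≤ inner ℝ (G x y) p - c := fun q t c => by
    rw [inner_sub_left, real_inner_comm (G x y) q, real_inner_comm (G x y) p]
    constructor <;> intro h <;> linarith
  simp only [hrw]
  constructor
  · rintro ⟨h0, c, hc, hmax⟩
    refine ⟨c, hc, ?_, hmax⟩
    rw [h0, hasGradientAt_iff_hasFDerivAt, map_zero] at hgrad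
    have hconv := (convexOn_add_inner (hgconv x) (hGconv x)
      (nonneg_of_conj_le hproper hmono hc.le)).add_const (-(conj h p).toReal)
    intro y'
    have := ConvexOn.le_of_hasFDerivAt_zero hconv hgrad y'
    simpa using this
  · rintro ⟨c, hc, hmin, hmax⟩
    refine ⟨?_, c, hc, hmax⟩
    rw [hasGradientAt_iff_hasFDerivAt] at hgrad
    have : IsLocalMin (fun y' => lagrangian g G h x y' p) y :=
      Eventually.of_forall fun y' => by simpa [lagrangian] using hmin y'
    exact (InnerProductSpace.toDual ℝ (E m)).map_eq_zero_iff.1 (this.hasFDerivAt_eq_zero hgrad)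

/-- All saddle points share one value e. At a convex combination, convexity in y gives the upper
bound e and concavity in the multiplier the lower bound e. -/
theorem convex_solutionMap (hg : ContDiff ℝ 2 (Function.uncurry g))
    (hG : ContDiff ℝ 2 (Function.uncurry G))
    (hgconv : ∀ x, ConvexOn ℝ Set.univ (fun y => g x y))
    (hGconv : ∀ x i, ConvexOn ℝ Set.univ (fun y => G x y i))
    (hproper : IsProper h) (hmono : IsNondecreasing h) (x : E n) :
    Convex ℝ (solutionMap g G h x) := by
  rintro ⟨y₁, p₁⟩ h₁ ⟨y₂, p₂⟩ h₂ a b ha hb hab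
  have iff := @mem_solutionMap_iff_saddle n m s g G h hg hG hgconv hGconv hproper hmono x
  obtain ⟨c₁, hc₁, hmin₁, hmax₁⟩ := iff.1 h₁
  obtain ⟨c₂, hc₂, hmin₂, hmax₂⟩ := iff.1 h₂
  have hle : conj h (a • p₁ + b • p₂) ≤ ((a * c₁ + b * c₂ : ℝ) : EReal) :=
    convex_epigraph_conj hproper.2 (toLp_mem_epigraph.2 hc₁.le) (toLp_mem_epigraph.2 hc₂.le)
      ha hb hab
  obtain ⟨c, hc⟩ : ∃ c : ℝ, conj h (a • p₁ + b • p₂) = c := by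
    refine ⟨_, (EReal.coe_toReal ?_ (conj_ne_bot hproper _)).symm⟩
    exact (hle.trans_lt (EReal.coe_lt_top _)).ne
  have hcle : c ≤ a * c₁ + b * c₂ := EReal.coe_le_coe_iff.1 (hc ▸ hle)
  obtain ⟨e, he⟩ : ∃ e, e = g x y₁ + inner ℝ (G x y₁) p₁ - c₁ := ⟨_, rfl⟩
  -- Cross-testing each saddle point against the other gives both inequalities.
  have he₂ : e = g x y₂ + inner ℝ (G x y₂) p₂ - c₂ := by
    linarith [hmin₁ y₂, hmin₂ y₁, hmax₁ p₂ c₂ hc₂.le, hmax₂ p₁ c₁ hc₁.le]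
  have hconvle : ∀ (q : E s) (t : ℝ), conj h q ≤ t →
      g x (a • y₁ + b • y₂) + inner ℝ (G x (a • y₁ + b • y₂)) q - t ≤ e := by
    intro q t hq
    have h1 := (convexOn_add_inner (hgconv x) (hGconv x)
      (nonneg_of_conj_le hproper hmono hq)).2 (Set.mem_univ y₁) (Set.mem_univ y₂) ha hb hab
    simp only [smul_eq_mul] at h1
    have h2 : g x y₁ + inner ℝ (G x y₁) q ≤ e + t := by linarith [hmax₁ q t hq]
    have h3 : g x y₂ + inner ℝ (G x y₂) q ≤ e + t := by linarith [hmax₂ q t hq]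
    have h4 := mul_le_mul_of_nonneg_left h2 ha
    have h5 := mul_le_mul_of_nonneg_left h3 hb
    have h6 : e + t = a * (e + t) + b * (e + t) := by rw [← add_mul, hab, one_mul]
    linarith
  have hge : ∀ y', e ≤ g x y' + inner ℝ (G x y') (a • p₁ + b • p₂) - c := by
    intro y'
    rw [inner_add_right, real_inner_smul_right, real_inner_smul_right]
    have h2 : e + c₁ - g x y' ≤ inner ℝ (G x y') p₁ := by linarith [hmin₁ y']
    have h3 : e + c₂ - g x y' ≤ inner ℝ (G x y') p₂ := by linarith [hmin₂ y']
    have h4 := mul_le_mul_of_nonneg_left h2 ha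
    have h5 := mul_le_mul_of_nonneg_left h3 hb
    have h6 : e - g x y' = a * (e - g x y') + b * (e - g x y') := by rw [← add_mul, hab, one_mul]
    linarith
  change (a • y₁ + b • y₂, a • p₁ + b • p₂) ∈ solutionMap g G h x
  refine iff.2 ⟨c, hc, fun y' => ?_, fun q t hq => ?_⟩
  · linarith [hconvle _ c hc.le, hge y']
  · linarith [hconvle q t hq, hge (a • y₁ + b • y₂)]

/-- The segment from q to any other point of C would enter N at points different from q. -/
theorem eq_singleton_of_convex_of_nhds {F : Type*} [NormedAddCommGroup F] [NormedSpace ℝ F]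
    {C N : Set F} (hC : Convex ℝ C) {q : F} (hq : q ∈ C) (hN : N ∈ 𝓝 q)
    (h : ∀ z ∈ C, z ∈ N → z = q) : C = {q} := by
  refine Set.eq_singleton_iff_unique_mem.2 ⟨hq, fun z hz => ?_⟩
  have hcont : Continuous fun t : ℝ => q + t • (z - q) := by fun_prop
  have hev : ∀ᶠ t in 𝓝[>] (0 : ℝ), q + t • (z - q) ∈ N :=
    ((hcont.tendsto' 0 q (by simp)).eventually hN).filter_mono nhdsWithin_le_nhds
  obtain ⟨t, htN, ht⟩ := (hev.and (Ioo_mem_nhdsGT (zero_lt_one' ℝ))).exists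
  have := h _ (hC.add_smul_sub_mem hq hz ⟨ht.1.le, ht.2.le⟩) htN
  rw [add_eq_left, smul_eq_zero, sub_eq_zero] at this
  exact this.resolve_left ht.1.ne'

end Saddle
end BilevelENLP

/-! ### The reduced smooth system and the implicit function theorem. -/

namespace BilevelENLP

open Filter Topology

section LocalSolution

variable {n m s : ℕ} {g : E n → E m → ℝ} {G : E n → E m → E s} {h : E s → EReal}

theorem contDiff_fderiv_section {F : Type*} [NormedAddCommGroup F] [NormedSpace ℝ F]
    {f : E n → E m → F} (hf : ContDiff ℝ 2 (Function.uncurry f)) :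
    ContDiff ℝ 1 fun u : E n × E m => fderiv ℝ (fun y' => f u.1 y') u.2 := by
  refine ContDiff.fderiv (f := fun (u : E n × E m) y' => f u.1 y') (m := 2) ?_ contDiff_snd
    (by norm_num)
  exact hf.comp (contDiff_fst.fst.prodMk contDiff_snd)

theorem contDiff_gradient_section {f : E n → E m → ℝ} (hf : ContDiff ℝ 2 (Function.uncurry f)) :
    ContDiff ℝ 1 fun u : E n × E m => gradient (fun y' => f u.1 y') u.2 := by
  rw [contDiff_euclidean]
  intro i
  have : ∀ u : E n × E m, gradient (fun y' => f u.1 y') u.2 i =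
      fderiv ℝ (fun y' => f u.1 y') u.2 (EuclideanSpace.single i 1) := fun u => by
    have h1 : inner ℝ (gradient (fun y' => f u.1 y') u.2) (EuclideanSpace.single i 1) =
      fderiv ℝ (fun y' => f u.1 y') u.2 (EuclideanSpace.single i 1) := by simp [gradient]
    rw [← h1, EuclideanSpace.inner_single_right]
    simp
  simp only [this]
  exact (contDiff_fderiv_section hf).clm_apply contDiff_const

theorem contDiff_adjoint_apply {X : Type*} [NormedAddCommGroup X] [NormedSpace ℝ X]
    {A : X → E m →L[ℝ] E s} {q : X → E s} (hA : ContDiff ℝ 1 A) (hq : ContDiff ℝ 1 q) :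
    ContDiff ℝ 1 fun u => ContinuousLinearMap.adjoint (A u) (q u) := by
  rw [contDiff_euclidean]
  intro i
  have : ∀ u, ContinuousLinearMap.adjoint (A u) (q u) i =
      inner ℝ (q u) (A u (EuclideanSpace.single i 1)) := fun u => by
    rw [← ContinuousLinearMap.adjoint_inner_left, EuclideanSpace.inner_single_right]
    simp
  simp only [this]
  exact hq.inner ℝ (hA.clm_apply contDiff_const)

theorem contDiff_lagrangian (hg : ContDiff ℝ 2 (Function.uncurry g))
    (hG : ContDiff ℝ 2 (Function.uncurry G)) (p : E s) :
    ContDiff ℝ 2 (Function.uncurry fun x y => lagrangian g G h x y p) :=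
  (hg.add (hG.inner ℝ contDiff_const)).sub contDiff_const

/-- The optimality system for `S`, with multipliers restricted to `p + K` and the constraint
residual projected to `K`. -/
noncomputable def reducedSystem (g : E n → E m → ℝ) (G : E n → E m → E s) (h : E s → EReal)
    (p v : E s) (K : Submodule ℝ (E s)) (u : E n × (E m × K)) : E m × K :=
  (gradient (fun y' => lagrangian g G h u.1 y' p) u.2.1 +
    ContinuousLinearMap.adjoint (Gy G u.1 u.2.1) (u.2.2 : E s),
    K.orthogonalProjectionOnto (G u.1 u.2.1 - v))

theorem contDiff_reducedSystem (hg : ContDiff ℝ 2 (Function.uncurry g))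
    (hG : ContDiff ℝ 2 (Function.uncurry G)) (p v : E s) (K : Submodule ℝ (E s)) :
    ContDiff ℝ 1 (reducedSystem g G h p v K) := by
  have hxy : ContDiff ℝ 1 fun u : E n × (E m × K) => (u.1, u.2.1) :=
    contDiff_fst.prodMk contDiff_snd.fst
  refine ContDiff.prodMk (ContDiff.add ?_ ?_) ?_
  · exact (contDiff_gradient_section (contDiff_lagrangian hg hG p)).comp hxy
  · exact contDiff_adjoint_apply ((contDiff_fderiv_section hG).comp hxy)
      (K.subtypeL.contDiff.comp contDiff_snd.snd)
  · exact K.orthogonalProjectionOnto.contDiff.comp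
      (((hG.of_le (by norm_num)).comp hxy).sub contDiff_const)

theorem reducedSystem_eq_zero_iff (hg : ContDiff ℝ 2 (Function.uncurry g))
    (hG : ContDiff ℝ 2 (Function.uncurry G)) {p v : E s} {K : Submodule ℝ (E s)} {x : E n}
    {y : E m} {k : K} :
    reducedSystem g G h p v K (x, y, k) = 0 ↔
      gradient (fun y' => g x y') y + ContinuousLinearMap.adjoint (Gy G x y) (p + k) = 0 ∧
        G x y - v ∈ Kᗮ := by
  simp only [reducedSystem, Prod.mk_eq_zero, Submodule.orthogonalProjectionOnto_eq_zero_iff,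
    (hasGradientAt_lagrangian hg hG x y p).gradient, map_add, add_assoc]

/-- The three partial derivatives are computed separately. The base point has k = 0, so the
multiplier term drops out of the x and y partials, leaving `Lxy` and `Lyy`. -/
theorem fderiv_reducedSystem_apply (hg : ContDiff ℝ 2 (Function.uncurry g))
    (hG : ContDiff ℝ 2 (Function.uncurry G)) (p v : E s) (K : Submodule ℝ (E s)) (x : E n) (y : E m)
    (ξ : E n) (w : E m) (k : K) :
    fderiv ℝ (reducedSystem g G h p v K) (x, y, 0) (ξ, w, k) =
      (Lxy g G h x y p ξ + Lyy g G h x y p w + ContinuousLinearMap.adjoint (Gy G x y) (k : E s),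
        K.orthogonalProjectionOnto (Gx G x y ξ + Gy G x y w)) := by
  have hF := ((contDiff_reducedSystem (h := h) hg hG p v K).differentiable (by norm_num)
    (x, y, 0)).hasFDerivAt
  set F' := fderiv ℝ (reducedSystem g G h p v K) (x, y, 0)
  have hGd : Differentiable ℝ (Function.uncurry G) := hG.differentiable (by norm_num)
  have h1 : F' (ξ, 0, 0) = (Lxy g G h x y p ξ, K.orthogonalProjectionOnto (Gx G x y ξ)) := by
    have hc : HasFDerivAt (fun x' => reducedSystem g G h p v K (x', y, 0))
        (F'.comp (.inl ℝ (E n) (E m × K))) x := by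
      have hin : HasFDerivAt (fun x' : E n => (x', ((y, 0) : E m × K))) (.inl ℝ (E n) (E m × K)) x :=
        hasFDerivAt_prodMk_left x _
      exact HasFDerivAt.comp (g := reducedSystem g G h p v K) x hF hin
    refine Prod.ext ?_ ?_
    · have := hc.fst.fderiv
      simp only [reducedSystem, Submodule.coe_zero, map_zero, add_zero] at this
      exact (congrArg (fun T => T ξ) this).symm
    · have h2 := hc.snd.fderiv
      have h3 : HasFDerivAt (fun x' => G x' y) (Gx G x y) x :=
        (hGd.comp (differentiable_id.prodMk (differentiable_const y)) x).hasFDerivAt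
      have h4 := (K.orthogonalProjectionOnto.hasFDerivAt.comp x (h3.sub_const v)).fderiv
      exact (congrArg (fun T => T ξ) (h2.symm.trans h4))
  have h2 : F' (0, w, 0) = (Lyy g G h x y p w, K.orthogonalProjectionOnto (Gy G x y w)) := by
    have hc : HasFDerivAt (fun y' => reducedSystem g G h p v K (x, y', 0))
        (F'.comp ((ContinuousLinearMap.inr ℝ (E n) (E m × K)).comp (.inl ℝ (E m) K))) y := by
      have hin : HasFDerivAt (fun y' : E m => (x, (y', (0 : K))))
          ((ContinuousLinearMap.inr ℝ (E n) (E m × K)).comp (.inl ℝ (E m) K)) y :=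
        HasFDerivAt.comp (g := fun q : E m × K => (x, q)) y (hasFDerivAt_prodMk_right x _)
          (hasFDerivAt_prodMk_left y (0 : K))
      exact HasFDerivAt.comp (g := reducedSystem g G h p v K) y hF hin
    refine Prod.ext ?_ ?_
    · have := hc.fst.fderiv
      simp only [reducedSystem, Submodule.coe_zero, map_zero, add_zero] at this
      exact (congrArg (fun T => T w) this).symm
    · have h2 := hc.snd.fderiv
      have h3 : HasFDerivAt (fun y' => G x y') (Gy G x y) y :=
        (differentiable_section hG x y).hasFDerivAt
      have h4 := (K.orthogonalProjectionOnto.hasFDerivAt.comp y (h3.sub_const v)).fderiv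
      exact (congrArg (fun T => T w) (h2.symm.trans h4))
  have h3 : F' (0, 0, k) = (ContinuousLinearMap.adjoint (Gy G x y) (k : E s), 0) := by
    have hc : HasFDerivAt (fun k' : K => reducedSystem g G h p v K (x, y, k'))
        (F'.comp ((ContinuousLinearMap.inr ℝ (E n) (E m × K)).comp (.inr ℝ (E m) K))) 0 := by
      have hin : HasFDerivAt (fun k' : K => (x, (y, k')))
          ((ContinuousLinearMap.inr ℝ (E n) (E m × K)).comp (.inr ℝ (E m) K)) 0 :=
        HasFDerivAt.comp (g := fun q : E m × K => (x, q)) 0 (hasFDerivAt_prodMk_right x _)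
          (hasFDerivAt_prodMk_right y (0 : K))
      exact HasFDerivAt.comp (g := reducedSystem g G h p v K) 0 hF hin
    have hd : HasFDerivAt (fun k' : K => reducedSystem g G h p v K (x, y, k'))
        (((ContinuousLinearMap.adjoint (Gy G x y)).comp K.subtypeL).prod 0) 0 :=
      HasFDerivAt.prodMk
        (HasFDerivAt.const_add (gradient (fun y' => lagrangian g G h x y' p) y)
          ((ContinuousLinearMap.adjoint (Gy G x y)).comp K.subtypeL).hasFDerivAt)
        (hasFDerivAt_const (K.orthogonalProjectionOnto (G x y - v)) 0)
    exact congrArg (fun T => T k) (hc.unique hd)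
  have hsum : ((ξ, w, k) : E n × (E m × K)) = (ξ, 0, 0) + (0, w, 0) + (0, 0, k) := by simp
  rw [hsum, map_add, map_add, h1, h2, h3]
  simp

/-- The implicit function theorem for the reduced optimality system. -/
theorem exists_local_solution (hg : ContDiff ℝ 2 (Function.uncurry g))
    (hG : ContDiff ℝ 2 (Function.uncurry G)) {x : E n} {y : E m} {p : E s} (K : Submodule ℝ (E s))
    (hstat : gradient (fun y' => g x y') y + ContinuousLinearMap.adjoint (Gy G x y) p = 0)
    (hinj : ∀ w, ∀ k ∈ K, Lyy g G h x y p w + ContinuousLinearMap.adjoint (Gy G x y) k = 0 →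
      Gy G x y w ∈ Kᗮ → w = 0 ∧ k = 0) :
    ∃ (σy : E n → E m) (σp : E n → E s), ContDiffAt ℝ 1 σy x ∧ ContDiffAt ℝ 1 σp x ∧
      (∀ᶠ u : E n × E m × E s in 𝓝 (x, y, p),
        (gradient (fun y' => g u.1 y') u.2.1 +
            ContinuousLinearMap.adjoint (Gy G u.1 u.2.1) u.2.2 = 0 ∧
          u.2.2 - p ∈ K ∧ G u.1 u.2.1 - G x y ∈ Kᗮ) ↔ u.2 = (σy u.1, σp u.1)) ∧
      ∀ ξ, fderiv ℝ σp x ξ ∈ K ∧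
        Lxy g G h x y p ξ + Lyy g G h x y p (fderiv ℝ σy x ξ) +
          ContinuousLinearMap.adjoint (Gy G x y) (fderiv ℝ σp x ξ) = 0 ∧
        Gx G x y ξ + Gy G x y (fderiv ℝ σy x ξ) ∈ Kᗮ := by
  set F := reducedSystem g G h p (G x y) K with hF
  have hFc : ContDiffAt ℝ 1 F (x, y, 0) := (contDiff_reducedSystem hg hG _ _ _).contDiffAt
  have hF0 : F (x, y, 0) = 0 := by
    rw [hF, reducedSystem_eq_zero_iff hg hG]
    simpa using hstat
  have hF' := fderiv_reducedSystem_apply (h := h) hg hG p (G x y) K x y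
  -- An injective endomorphism in finite dimension is invertible, and `hinj` says that the kernel is
  -- trivial.
  have hinv : (fderiv ℝ F (x, y, 0) ∘L .inr ℝ (E n) (E m × K)).IsInvertible := by
    have hker : Function.Injective
        ((fderiv ℝ F (x, y, 0) ∘L .inr ℝ (E n) (E m × K) : E m × K →L[ℝ] E m × K) :
          E m × K →ₗ[ℝ] E m × K) := by
      rw [← LinearMap.ker_eq_bot, LinearMap.ker_eq_bot']
      rintro ⟨w, k⟩ hwk
      change fderiv ℝ F (x, y, 0) (0, w, k) = 0 at hwk
      rw [hF', Prod.mk_eq_zero, map_zero, map_zero, zero_add, zero_add,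
        Submodule.orthogonalProjectionOnto_eq_zero_iff] at hwk
      obtain ⟨rfl, hk⟩ := hinj w k k.2 hwk.1 hwk.2
      rw [Submodule.coe_eq_zero.1 hk, Prod.mk_zero_zero]
    exact ⟨(LinearEquiv.ofInjectiveEndo _ hker).toContinuousLinearEquiv, by ext u <;> rfl⟩
  set ψ := hFc.implicitFunction one_ne_zero hinv with hψ
  have hψc : ContDiffAt ℝ 1 ψ x := hFc.contDiffAt_implicitFunction one_ne_zero hinv
  have hψx : ψ x = (y, 0) := hFc.implicitFunction_apply_self one_ne_zero hinv
  have hψd := (hψc.differentiableAt one_ne_zero).hasFDerivAt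
  have hσy : HasFDerivAt (fun x' => (ψ x').1)
      ((ContinuousLinearMap.fst ℝ (E m) K).comp (fderiv ℝ ψ x)) x := hψd.fst
  have hσp : HasFDerivAt (fun x' => p + ((ψ x').2 : E s))
      (K.subtypeL.comp ((ContinuousLinearMap.snd ℝ (E m) K).comp (fderiv ℝ ψ x))) x :=
    (K.subtypeL.hasFDerivAt.comp x hψd.snd).const_add p
  refine ⟨fun x' => (ψ x').1, fun x' => p + ((ψ x').2 : E s), contDiffAt_fst.comp x hψc,
    contDiffAt_const.add (K.subtypeL.contDiff.contDiffAt.comp x (contDiffAt_snd.comp x hψc)),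
    ?_, ?_⟩
  · have hcont : Continuous fun u : E n × E m × E s =>
        ((u.1, u.2.1, K.orthogonalProjectionOnto (u.2.2 - p)) : E n × E m × K) := by fun_prop
    have hev := (hcont.tendsto' (x, y, p) (x, y, 0) (by simp)).eventually
      (hFc.eventually_apply_eq_iff_implicitFunction one_ne_zero hinv)
    filter_upwards [hev] with ⟨x', y', p'⟩ hu
    rw [hF0, reducedSystem_eq_zero_iff hg hG] at hu
    simp only [Prod.mk.injEq] at hu ⊢
    -- The system only sees the projection of p' - p to K; off p + K both sides of the equivalence
    -- fail.
    by_cases hp : p' - p ∈ K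
    · have hproj : K.orthogonalProjectionOnto (p' - p) = ⟨p' - p, hp⟩ :=
        K.orthogonalProjectionOnto_mem_subspace_eq_self ⟨p' - p, hp⟩
      rw [hproj, add_sub_cancel] at hu
      refine (Iff.trans ?_ hu).trans ?_
      · simp [hp]
      · change ψ x' = _ ↔ _
        rw [Prod.ext_iff, Subtype.ext_iff]
        refine and_congr eq_comm ?_
        exact (eq_sub_iff_add_eq'.trans eq_comm)
    · refine iff_of_false (fun h => hp h.2.1) fun h => hp ?_
      rw [h.2, add_sub_cancel_left]
      exact Submodule.coe_mem _
  · intro ξ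
    -- Differentiating the identity that F is constant along the implicit branch.
    have hzero : fderiv ℝ F (x, y, 0) (ξ, fderiv ℝ ψ x ξ) = 0 := by
      have hFd : HasFDerivAt F (fderiv ℝ F (x, y, 0)) (x, ψ x) :=
        hψx ▸ (hFc.differentiableAt one_ne_zero).hasFDerivAt
      have h1 := HasFDerivAt.comp x hFd ((hasFDerivAt_id x).prodMk hψd)
      have h2 : HasFDerivAt (fun x' => F (x', ψ x')) (0 : E n →L[ℝ] E m × K) x :=
        (hasFDerivAt_const (F (x, y, 0)) x).congr_of_eventuallyEq
          (hFc.eventually_apply_implicitFunction one_ne_zero hinv)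
      exact congrArg (fun T => T ξ) (h1.unique h2)
    rw [show fderiv ℝ ψ x ξ = ((fderiv ℝ ψ x ξ).1, (fderiv ℝ ψ x ξ).2) from rfl, hF',
      Prod.mk_eq_zero, Submodule.orthogonalProjectionOnto_eq_zero_iff] at hzero
    rw [hσy.fderiv, hσp.fderiv]
    exact ⟨Submodule.coe_mem _, hzero⟩

end LocalSolution
end BilevelENLP

/-! ### The KKT matrix and the Jacobian formula. -/

namespace BilevelENLP

open Filter Topology Matrix

section KKTMatrix

theorem mat_mulVec {a b : ℕ} (T : E a →L[ℝ] E b) (w : E a) : mat T *ᵥ ⇑w = ⇑(T w) := by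
  have h1 : ∀ {c : ℕ} (v : E c),
      ⇑((EuclideanSpace.basisFun (Fin c) ℝ).toBasis.repr v) = ⇑v := fun v => by
    ext i
    rw [OrthonormalBasis.coe_toBasis_repr_apply, EuclideanSpace.basisFun_repr]
  have h2 := LinearMap.toMatrix_mulVec_repr (EuclideanSpace.basisFun (Fin a) ℝ).toBasis
    (EuclideanSpace.basisFun (Fin b) ℝ).toBasis (T : E a →ₗ[ℝ] E b) w
  rwa [h1, h1] at h2

theorem transpose_mat {a b : ℕ} (T : E a →L[ℝ] E b) :
    (mat T)ᵀ = mat (ContinuousLinearMap.adjoint T) := by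
  ext i j
  have h1 : mat T j i = T (EuclideanSpace.single i 1) j := by simp [mat, LinearMap.toMatrix_apply]
  have h2 : mat (ContinuousLinearMap.adjoint T) i j =
      ContinuousLinearMap.adjoint T (EuclideanSpace.single j 1) i := by
    simp [mat, LinearMap.toMatrix_apply]
  have h3 := ContinuousLinearMap.adjoint_inner_left T (EuclideanSpace.single i 1)
    (EuclideanSpace.single j 1)
  rw [EuclideanSpace.inner_single_right, EuclideanSpace.inner_single_left] at h3
  rw [transpose_apply, h1, h2]
  simpa using h3.symm

theorem sumElim_dotProduct_sumElim {m s : ℕ} (a w : E m) (b z : E s) :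
    Sum.elim ⇑a ⇑b ⬝ᵥ Sum.elim ⇑w ⇑z = inner ℝ w a + inner ℝ z b := by
  simp [dotProduct, PiLp.inner_apply]

theorem sumElim_mem_univProd {m s : ℕ} {K : Set (E s)} (w : E m) {z : E s} (hz : z ∈ K) :
    Sum.elim ⇑w ⇑z ∈ univProd m K := ⟨w, z, hz, rfl⟩

variable {n m s : ℕ} {g : E n → E m → ℝ} {G : E n → E m → E s} {h : E s → EReal}

theorem kktMatrix_mulVec (x : E n) (y : E m) (p : E s) (w : E m) (z : E s) :
    kktMatrix g G h x y p *ᵥ Sum.elim ⇑w ⇑z =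
      Sum.elim ⇑(Lyy g G h x y p w + ContinuousLinearMap.adjoint (Gy G x y) z)
        ⇑(Gy G x y w) := by
  rw [kktMatrix, fromBlocks_mulVec, transpose_mat]
  simp [Function.comp_def, mat_mulVec]

theorem ColumnsFormBasis.mem_iff {ι : Type*} {d : ℕ} {B : Matrix ι (Fin d) ℝ}
    {C : Set (ι → ℝ)} (hB : ColumnsFormBasis B C) {v : ι → ℝ} : v ∈ C ↔ ∃ c, B *ᵥ c = v := by
  rw [← hB.2, SetLike.mem_coe, ← Matrix.range_mulVecLin, LinearMap.mem_range]
  rfl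

/-- Multiplying by Bᵀ tests against the columns of B, which span C. -/
theorem transpose_mulVec_eq_zero {ι : Type*} [Fintype ι] {d : ℕ} {B : Matrix ι (Fin d) ℝ}
    {C : Set (ι → ℝ)} (hB : ColumnsFormBasis B C) {u : ι → ℝ} :
    Bᵀ *ᵥ u = 0 ↔ ∀ v ∈ C, u ⬝ᵥ v = 0 := by
  constructor
  · intro h v hv
    obtain ⟨c, rfl⟩ := hB.mem_iff.1 hv
    rw [dotProduct_mulVec, ← mulVec_transpose, h, zero_dotProduct]
  · intro h
    ext i
    have := h (B *ᵥ Pi.single i 1) (hB.mem_iff.2 ⟨_, rfl⟩)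
    rw [dotProduct_mulVec, ← mulVec_transpose, dotProduct_single_one] at this
    exact this

/-- The Jacobian formula, from the linearized optimality system on `ℝᵐ × K`. -/
theorem jacobian_formula {x : E n} {y : E m} {p : E s} (K : Submodule ℝ (E s))
    (hinj : ∀ w, ∀ k ∈ K, Lyy g G h x y p w + ContinuousLinearMap.adjoint (Gy G x y) k = 0 →
      Gy G x y w ∈ Kᗮ → w = 0 ∧ k = 0)
    {T : E n →L[ℝ] E m} {Q : E n →L[ℝ] E s}
    (hTQ : ∀ ξ, Q ξ ∈ K ∧ Lxy g G h x y p ξ + Lyy g G h x y p (T ξ) +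
          ContinuousLinearMap.adjoint (Gy G x y) (Q ξ) = 0 ∧
        Gx G x y ξ + Gy G x y (T ξ) ∈ Kᗮ)
    {d : ℕ} {B : Matrix (Fin m ⊕ Fin s) (Fin d) ℝ}
    (hB : ColumnsFormBasis B (univProd m (K : Set (E s)))) :
    IsUnit (Bᵀ * kktMatrix g G h x y p * B) ∧
      fromRows (mat T) (mat Q) = - (B * (Bᵀ * kktMatrix g G h x y p * B)⁻¹ * Bᵀ *
        fromRows (mat (Lxy g G h x y p)) (mat (Gx G x y))) := by
  have hunit : IsUnit (Bᵀ * kktMatrix g G h x y p * B) := by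
    rw [← mulVec_injective_iff_isUnit]
    change Function.Injective (Bᵀ * kktMatrix g G h x y p * B).mulVecLin
    rw [← LinearMap.ker_eq_bot, LinearMap.ker_eq_bot']
    intro c hc
    rw [mulVecLin_apply, ← mulVec_mulVec, ← mulVec_mulVec] at hc
    obtain ⟨w, z, hz, hwz⟩ := hB.mem_iff.2 ⟨c, rfl⟩
    rw [hwz, kktMatrix_mulVec, transpose_mulVec_eq_zero hB] at hc
    have h1 : Lyy g G h x y p w + ContinuousLinearMap.adjoint (Gy G x y) z = 0 := by
      have := hc _ (sumElim_mem_univProd (Lyy g G h x y p w + ContinuousLinearMap.adjoint (Gy G x y) z)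
        K.zero_mem)
      rw [sumElim_dotProduct_sumElim, inner_zero_left, add_zero] at this
      exact inner_self_eq_zero.1 this
    have h2 : Gy G x y w ∈ Kᗮ := by
      rw [Submodule.mem_orthogonal]
      intro k hk
      have := hc _ (sumElim_mem_univProd 0 hk)
      rwa [sumElim_dotProduct_sumElim, inner_zero_left, zero_add] at this
    obtain ⟨rfl, rfl⟩ := hinj w z hz h1 h2
    refine mulVec_injective_iff.2 hB.1 ?_
    rw [hwz, mulVec_zero]
    ext i
    rcases i with i | i <;> rfl
  refine ⟨hunit, ?_⟩
  set R := fromRows (mat (Lxy g G h x y p)) (mat (Gx G x y))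
  -- The vector c holds the coordinates in B of the j-th partial derivative of the branch, which
  -- lies in ℝᵐ × K.
  have hcol : ∀ j : Fin n, ∃ c, B *ᵥ c = (fromRows (mat T) (mat Q)) *ᵥ Pi.single j 1 ∧
      (Bᵀ * kktMatrix g G h x y p * B) *ᵥ c = -(Bᵀ * R) *ᵥ Pi.single j 1 := by
    intro j
    obtain ⟨ξ, hξ⟩ : ∃ ξ : E n, ⇑ξ = Pi.single j 1 := ⟨EuclideanSpace.single j 1, rfl⟩
    obtain ⟨hQ, h1, h2⟩ := hTQ ξ
    obtain ⟨c, hc⟩ := hB.mem_iff.1 (sumElim_mem_univProd (T ξ) hQ)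
    refine ⟨c, ?_, ?_⟩
    · rw [hc, ← hξ, fromRows_mulVec, mat_mulVec, mat_mulVec]
    · rw [← mulVec_mulVec, ← mulVec_mulVec, hc, kktMatrix_mulVec, neg_mulVec, ← mulVec_mulVec,
        ← sub_eq_zero, sub_neg_eq_add, ← mulVec_add, ← hξ, fromRows_mulVec, mat_mulVec,
        mat_mulVec, transpose_mulVec_eq_zero hB]
      -- The linearized residual has zero first block and second block in Kᗮ, so Bᵀ annihilates it.
      have hadd : Sum.elim ⇑(Lyy g G h x y p (T ξ) + ContinuousLinearMap.adjoint (Gy G x y) (Q ξ))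
          ⇑(Gy G x y (T ξ)) + Sum.elim ⇑(Lxy g G h x y p ξ) ⇑(Gx G x y ξ) =
          Sum.elim ⇑(0 : E m) ⇑(Gx G x y ξ + Gy G x y (T ξ)) := by
        rw [← h1]
        ext i
        rcases i with i | i
        · simp
          ring
        · simp [add_comm]
      rintro v ⟨w, z, hz, rfl⟩
      rw [hadd, sumElim_dotProduct_sumElim, inner_zero_right, zero_add]
      exact K.inner_right_of_mem_orthogonal hz h2
  refine ext_of_mulVec_single fun j => ?_
  obtain ⟨c, hc, hc'⟩ := hcol j
  have hdet := (Matrix.isUnit_iff_isUnit_det _).1 hunit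
  have : c = (Bᵀ * kktMatrix g G h x y p * B)⁻¹ *ᵥ (-(Bᵀ * R) *ᵥ Pi.single j 1) := by
    rw [← hc', mulVec_mulVec, nonsing_inv_mul _ hdet, one_mulVec]
  rw [← hc, this, mulVec_mulVec, mulVec_mulVec]
  congr 1
  simp only [Matrix.mul_neg, Matrix.mul_assoc]

end KKTMatrix
end BilevelENLP

/-! ### Assembly of the theorem. -/

open BilevelENLP Filter Topology

theorem theorem3 {n m s : ℕ}
    (g : EuclideanSpace ℝ (Fin n) → EuclideanSpace ℝ (Fin m) → ℝ)
    (G : EuclideanSpace ℝ (Fin n) → EuclideanSpace ℝ (Fin m) → EuclideanSpace ℝ (Fin s))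
    (h : EuclideanSpace ℝ (Fin s) → EReal)
    (hg : ContDiff ℝ 2 (Function.uncurry g))
    (hG : ContDiff ℝ 2 (Function.uncurry G))
    (hgconv : ∀ x, ConvexOn ℝ Set.univ (fun y => g x y))
    (hGconv : ∀ x i, ConvexOn ℝ Set.univ (fun y => G x y i))
    (hproper : BilevelENLP.IsProper h)
    (hpoly : BilevelENLP.IsEpiPolyhedral h)
    (hmono : BilevelENLP.IsNondecreasing h)
    (x : EuclideanSpace ℝ (Fin n)) (y : EuclideanSpace ℝ (Fin m)) (p : EuclideanSpace ℝ (Fin s))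
    (hqual : BilevelENLP.BasicQualification G h x y)
    (hsol : (y, p) ∈ BilevelENLP.solutionMap g G h x)
    (hri : G x y ∈ intrinsicInterior ℝ (BilevelENLP.subdiff (BilevelENLP.conj h) p))
    (hsoc : BilevelENLP.SecondOrderCondition g G h x y p) :
    -- `S(x) = {(y, p)}`
    BilevelENLP.solutionMap g G h x = {(y, p)} ∧
    -- `K_{h*}(p, G(x, y))` is a linear subspace, so bases of `ℝᵐ × K_{h*}(p, G(x, y))` make sense
    (∃ W : Submodule ℝ (EuclideanSpace ℝ (Fin s)),
      (W : Set (EuclideanSpace ℝ (Fin s))) =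
        BilevelENLP.criticalCone (BilevelENLP.conj h) p (G x y)) ∧
    -- `S` is single-valued and `C¹` around `x`, with the Jacobian formula at `x`
    ∃ (U : Set (EuclideanSpace ℝ (Fin n)))
      (σy : EuclideanSpace ℝ (Fin n) → EuclideanSpace ℝ (Fin m))
      (σp : EuclideanSpace ℝ (Fin n) → EuclideanSpace ℝ (Fin s)),
      IsOpen U ∧ x ∈ U ∧
      (∀ x' ∈ U, BilevelENLP.solutionMap g G h x' = {(σy x', σp x')}) ∧
      ContDiffOn ℝ 1 σy U ∧ ContDiffOn ℝ 1 σp U ∧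
      ∀ (d : ℕ) (B : Matrix (Fin m ⊕ Fin s) (Fin d) ℝ),
        BilevelENLP.ColumnsFormBasis B
          (BilevelENLP.univProd m
            (BilevelENLP.criticalCone (BilevelENLP.conj h) p (G x y))) →
        IsUnit (B.transpose * BilevelENLP.kktMatrix g G h x y p * B) ∧
        Matrix.fromRows (BilevelENLP.mat (fderiv ℝ σy x)) (BilevelENLP.mat (fderiv ℝ σp x)) =
          - (B * (B.transpose * BilevelENLP.kktMatrix g G h x y p * B)⁻¹ * B.transpose *
              Matrix.fromRows (BilevelENLP.mat (BilevelENLP.Lxy g G h x y p))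
                (BilevelENLP.mat (BilevelENLP.Gx G x y))) := by
  obtain ⟨M, hcrit, hgraph⟩ := subdiff_conj_locally_affine hproper hpoly hri
  have hstat := mem_solutionMap_iff.1 hsol
  have hinj : ∀ w, ∀ k ∈ Mᗮ, Lyy g G h x y p w + ContinuousLinearMap.adjoint (Gy G x y) k = 0 →
      Gy G x y w ∈ Mᗮᗮ → w = 0 ∧ k = 0 := by
    intro w k hk h1 h2
    refine hsoc w k (hcrit ▸ hk) (neg_eq_of_add_eq_zero_left h1) ?_
    rw [hcrit]
    intro z hz
    exact Submodule.inner_right_of_mem_orthogonal hz (neg_mem h2)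
  obtain ⟨σy, σp, hσy, hσp, hev, hderiv⟩ := exists_local_solution hg hG Mᗮ hstat.1 hinj
  -- Taking K = Mᗮ, the condition on G lies in Kᗮ = M, so the reduced system is the local
  -- description of the graph of ∂h*.
  have hsolev : ∀ᶠ u : E n × E m × E s in 𝓝 (x, y, p),
      u.2 ∈ solutionMap g G h u.1 ↔ u.2 = (σy u.1, σp u.1) := by
    have hcont : Continuous fun u : E n × E m × E s => (u.2.2, G u.1 u.2.1) :=
      continuous_snd.snd.prodMk (hG.continuous.comp (continuous_fst.prodMk continuous_snd.fst))
    filter_upwards [hev, (hcont.tendsto (x, y, p)).eventually hgraph] with ⟨x', y', p'⟩ h1 h2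
    rw [mem_solutionMap_iff, ← h1, h2, Submodule.orthogonal_orthogonal]
  have hbase : (y, p) = (σy x, σp x) := hsolev.self_of_nhds.1 hsol
  have hsingle : ∀ᶠ x' in 𝓝 x, solutionMap g G h x' = {(σy x', σp x')} := by
    have hcont : Tendsto (fun x' => (x', σy x', σp x')) (𝓝 x) (𝓝 (x, y, p)) := by
      rw [hbase]
      exact tendsto_id.prodMk_nhds (hσy.continuousAt.prodMk_nhds hσp.continuousAt)
    -- The local equivalence holds around each nearby point of the branch, so every such point is
    -- isolated in its own solution set.
    filter_upwards [hcont.eventually hsolev.eventually_nhds] with x' hx'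
    have hslice : ∀ᶠ q in 𝓝 (σy x', σp x'), q ∈ solutionMap g G h x' ↔ q = (σy x', σp x') :=
      ((Continuous.prodMk_right x').tendsto (σy x', σp x')).eventually hx'
    exact eq_singleton_of_convex_of_nhds
      (convex_solutionMap hg hG hgconv hGconv hproper hmono x') (hslice.self_of_nhds.2 rfl) hslice
      fun z hz hzN => hzN.1 hz
  refine ⟨hbase ▸ hsingle.self_of_nhds, ⟨Mᗮ, hcrit.symm⟩, ?_⟩
  obtain ⟨U, hU, hUo, hxU⟩ := eventually_nhds_iff.1 ((hsingle.and
    (hσy.eventually (by simp))).and (hσp.eventually (by simp)))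
  refine ⟨U, σy, σp, hUo, hxU, fun x' hx' => (hU x' hx').1.1,
    fun x' hx' => (hU x' hx').1.2.contDiffWithinAt, fun x' hx' => (hU x' hx').2.contDiffWithinAt,
    fun d B hB => ?_⟩
  rw [hcrit] at hB
  exact jacobian_formula Mᗮ hinj hderiv hB
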